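/- Let $(\Omega,\mathcal A,\mu)$ be a probability space and let $(T_t)_{t\in\mathbb R}$ be an ergodic measure-preserving flow on it: each $T_t:\Omega\to\Omega$ preserves $\mu$, $T_t\circ T_s=T_{t+s}$ for all $s,t\in\mathbb R$, the map $(t,\omega)\mapsto T_t\omega$ is measurable for the completion of the product of Lebesgue measure and $\mu$, and every $A\in\mathcal A$ with $\mu(T_t^{-1}A\,\triangle\,A)=0$ for all $t\in\mathbb R$ satisfies $\mu(A)\in\{0,1\}$. For $\theta\in\mathbb R$, say that the exponential $t\mapsto e^{2\pi i\theta t}$ is an eigenvalue of the flow if there is a nonzero $g\in L^2(\mu)$ such that, for every $t\in\mathbb R$, $g\circ T_t=e^{2\pi i\theta t}g$ $\mu$-almost everywhere. Then for every $f\in L^2(\mu)$ there is a measurable set $\Omega'\subseteq\Omega$ with $\mu(\Omega\setminus\Omega')=0$ such that for every $\omega\in\Omega'$ the function $t\mapsto f(T_t\omega)$ is integrable on every bounded interval with endpoint $0$, and for every $\theta\in\mathbb R$ for which $t\mapsto e^{2\pi i\theta t}$ is not an eigenvalue of the flow, $$\lim_{\tau\to+\infty}\frac1\tau\int_0^\tau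 f(T_t\omega)\,e^{2\pi i\theta t}\,dt=0 .$$ The set $\Omega'$ depends on $f$ but not on $\theta$. -/

import Mathlib

open MeasureTheory

/-- A measure-preserving flow `(T_t)_{t ∈ ℝ}` on `(Ω, μ)`: every `T_t` preserves `μ`,
`T_t ∘ T_s = T_{t+s}` for all real `t, s`, and `(t, ω) ↦ T_t ω` is measurable for the completion of
the product of Lebesgue measure and `μ`. (The completion is what makes the notion right both for
Borel flows and for flows on a complete Lebesgue space.) -/
structure IsMeasurableFlow {Ω : Type*} [MeasurableSpace Ω] (T : ℝ → Ω → Ω) (μ : Measure Ω) :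
    Prop where
  measurePreserving : ∀ t : ℝ, MeasurePreserving (T t) μ μ
  comp_eq : ∀ t s : ℝ, T t ∘ T s = T (t + s)
  nullMeasurable : NullMeasurable (fun p : ℝ × Ω => T p.1 p.2) ((volume : Measure ℝ).prod μ)

/-- The flow is ergodic: a measurable set that is invariant modulo `μ` under every `T_t` is null or
has null complement. -/
def IsErgodicFlow {Ω : Type*} [MeasurableSpace Ω] (T : ℝ → Ω → Ω) (μ : Measure Ω) : Prop :=
  ∀ A : Set Ω, MeasurableSet A → (∀ t : ℝ, T t ⁻¹' A =ᵐ[μ] A) → μ A = 0 ∨ μ Aᶜ = 0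

/-- The Koopman operator `U_t : g ↦ g ∘ T_t` on `L²(μ)`. -/
noncomputable def koopman {Ω : Type*} [MeasurableSpace Ω] {T : ℝ → Ω → Ω} {μ : Measure Ω}
    (hT : IsMeasurableFlow T μ) (t : ℝ) : Lp ℂ 2 μ →ₗᵢ[ℂ] Lp ℂ 2 μ :=
  Lp.compMeasurePreservingₗᵢ ℂ (T t) (hT.measurePreserving t)

/-- The exponential `t ↦ e^{2πiθt}` is an eigenvalue of the flow: the Koopman operators have a
common nonzero eigenfunction `g ∈ L²(μ)` with `U_t g = e^{2πiθt} g` for all `t`. -/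
def IsFlowEigenvalue {Ω : Type*} [MeasurableSpace Ω] {T : ℝ → Ω → Ω} {μ : Measure Ω}
    (hT : IsMeasurableFlow T μ) (θ : ℝ) : Prop :=
  ∃ g : Lp ℂ 2 μ, g ≠ 0 ∧
    ∀ t : ℝ, koopman hT t g = Complex.exp (2 * Real.pi * Complex.I * θ * t) • g

/-! Fix a non-eigenvalue `θ`. The twisted integrals form a cocycle over a unitary-type family on
`L²`; von Neumann's theorem and the absence of common fixed vectors give a window length `N` with
mean of `|∫_0^N f(T_t ω) e(θt) dt|` at most `εN` (`exists_integral_norm_le`).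

To pass from the mean to single orbits, note that `|∫_t^{t+N} f(T_s ω) e(θs) ds|` is a function of
the point `T_t ω` alone: the phase `e(θt)` disappears in the modulus. Up to boundary terms, `N`
times the integral over `[0, τ]` is the integral over `t` of these windows
(`mul_norm_primitive_le`), so the pointwise ergodic theorem for the window function bounds it.

The exceptional set must not depend on `θ`. The ergodic theorem is therefore applied only to the
countably many pairs of an integer `N` and a rational `q`. Replacing `θ` by a close `q` costs a
multiple of `|θ - q|` times the window integral of `|f|`, whose orbit averages are controlled too.
As all functions involved are nonnegative and only upper bounds are needed, half of the ergodic
theorem (`ae_eventually_integral_le`) suffices. -/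

namespace IsMeasurableFlow

/-! ### Measurability and integrability along orbits -/

variable {Ω : Type*} [MeasurableSpace Ω] {μ : Measure Ω} {T : ℝ → Ω → Ω}

theorem apply_apply (hT : IsMeasurableFlow T μ) (t s : ℝ) (ω : Ω) : T t (T s ω) = T (t + s) ω :=
  congrFun (hT.comp_eq t s) ω

variable [IsProbabilityMeasure μ]

/-- The map `(t, ω) ↦ T_t ω` pulls null sets back to null sets. -/
theorem tendsto_ae (hT : IsMeasurableFlow T μ) :
    Filter.Tendsto (fun p : ℝ × Ω => T p.1 p.2) (ae ((volume : Measure ℝ).prod μ)) (ae μ) := by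
  intro N hN
  obtain ⟨N', hNN', hN'm, hN'⟩ := exists_measurable_superset_of_null (mem_ae_iff.1 hN)
  have hS : NullMeasurableSet ((fun p : ℝ × Ω => T p.1 p.2) ⁻¹' N')
    ((volume : Measure ℝ).prod μ) := hT.nullMeasurable hN'm
  -- The preimage is measurable only for the completion; Fubini needs a genuinely measurable
  -- representative.
  obtain ⟨S, -, hSm, hSe⟩ := hS.exists_measurable_superset_ae_eq
  have h0 : ((volume : Measure ℝ).prod μ) S = 0 := by
    rw [Measure.measure_prod_null hSm]
    filter_upwards [Measure.ae_ae_of_ae_prod hSe] with t ht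
    have h1 : (Prod.mk t ⁻¹' S : Set Ω) =ᵐ[μ] T t ⁻¹' N' := ht
    rw [measure_congr h1, (hT.measurePreserving t).measure_preimage hN'm.nullMeasurableSet, hN']
    rfl
  rw [Filter.mem_map, mem_ae_iff]
  refine measure_mono_null (fun p hp => hNN' hp) ((measure_congr hSe).symm.trans h0)

theorem aestronglyMeasurable_uncurry (hT : IsMeasurableFlow T μ) {E : Type*}
    [NormedAddCommGroup E] [SecondCountableTopology E] {G : Ω → E}
    (hG : AEStronglyMeasurable G μ) :
    AEStronglyMeasurable (fun p : ℝ × Ω => G (T p.1 p.2)) ((volume : Measure ℝ).prod μ) := by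
  borelize E
  have h1 : AEMeasurable (fun p : ℝ × Ω => hG.mk G (T p.1 p.2)) ((volume : Measure ℝ).prod μ) :=
    (hG.stronglyMeasurable_mk.measurable.comp_nullMeasurable hT.nullMeasurable).aemeasurable
  exact h1.aestronglyMeasurable.congr (hT.tendsto_ae hG.ae_eq_mk.symm)

theorem integrable_uncurry (hT : IsMeasurableFlow T μ) {E : Type*}
    [NormedAddCommGroup E] [SecondCountableTopology E] {G : Ω → E}
    (hG : Integrable G μ) (ν : Measure ℝ) [IsFiniteMeasure ν] (hν : ν ≪ volume) :
    Integrable (fun p : ℝ × Ω => G (T p.1 p.2)) (ν.prod μ) := by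
  rw [integrable_prod_iff ((hT.aestronglyMeasurable_uncurry hG.1).mono_ac
    (hν.prod Measure.AbsolutelyContinuous.rfl))]
  refine ⟨.of_forall fun t => (hT.measurePreserving t).integrable_comp_of_integrable hG, ?_⟩
  have : (fun t => ∫ ω, ‖G (T t ω)‖ ∂μ) = fun _ => ∫ ω, ‖G ω‖ ∂μ := by
    ext t
    have h := integral_map (hT.measurePreserving t).aemeasurable (f := fun ω => ‖G ω‖)
      (by rw [(hT.measurePreserving t).map_eq]; exact hG.1.norm)
    rw [(hT.measurePreserving t).map_eq] at h
    exact h.symm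
  simp only [this]
  exact integrable_const _

/-- Almost every orbit of an integrable function is locally integrable. -/
theorem ae_intervalIntegrable (hT : IsMeasurableFlow T μ) {E : Type*}
    [NormedAddCommGroup E] [SecondCountableTopology E] {G : Ω → E}
    (hG : Integrable G μ) :
    ∀ᵐ ω ∂μ, ∀ a b : ℝ, IntervalIntegrable (fun t => G (T t ω)) volume a b := by
  have h : ∀ n : ℕ, ∀ᵐ ω ∂μ, IntegrableOn (fun t => G (T t ω)) (Set.Icc (-n : ℝ) n) := fun n =>
    (hT.integrable_uncurry hG (volume.restrict (Set.Icc (-n : ℝ) n))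
      Measure.absolutelyContinuous_restrict).prod_left_ae
  filter_upwards [ae_all_iff.2 h] with ω hω a b
  obtain ⟨n, hn⟩ := exists_nat_ge (max |a| |b|)
  rw [intervalIntegrable_iff]
  refine (hω n).mono_set (Set.uIoc_subset_uIcc.trans (Set.uIcc_subset_Icc ?_ ?_))
  · exact abs_le.1 ((le_max_left _ _).trans hn)
  · exact abs_le.1 ((le_max_right _ _).trans hn)

/-- Orbit integrals of an integrable function, with a bounded continuous weight, are integrable. -/
theorem integrable_intervalIntegral (hT : IsMeasurableFlow T μ) {E : Type*}
    [NormedRing E] [NormedAlgebra ℝ E] [SecondCountableTopology E] {G : Ω → E}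
    (hG : Integrable G μ) {e : ℝ → E} (he : Continuous e) (he1 : ∀ t, ‖e t‖ ≤ 1) (a b : ℝ) :
    Integrable (fun ω => ∫ t in a..b, G (T t ω) * e t) μ := by
  have h : ∀ a b : ℝ, Integrable (fun ω => ∫ t in Set.Ioc a b, G (T t ω) * e t) μ := fun a b =>
    Integrable.integral_prod_right (f := fun p : ℝ × Ω => G (T p.1 p.2) * e p.1)
      ((hT.integrable_uncurry hG (volume.restrict (Set.Ioc a b))
        Measure.absolutelyContinuous_restrict).mul_bdd (c := 1)
          he.aestronglyMeasurable.comp_fst (.of_forall fun p => he1 p.1))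
  exact (h a b).sub (h b a)

theorem integral_intervalIntegral (hT : IsMeasurableFlow T μ) {G : Ω → ℝ}
    (hG : Integrable G μ) {a b : ℝ} (hab : a ≤ b) :
    ∫ ω, (∫ t in a..b, G (T t ω)) ∂μ = (b - a) * ∫ ω, G ω ∂μ := by
  simp only [intervalIntegral.integral_of_le hab]
  rw [← integral_integral_swap (f := fun t ω => G (T t ω)) (hT.integrable_uncurry hG
    (volume.restrict (Set.Ioc a b)) Measure.absolutelyContinuous_restrict)]
  have : (fun t => ∫ ω, G (T t ω) ∂μ) = fun _ => ∫ ω, G ω ∂μ := by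
    ext t
    have h := integral_map (hT.measurePreserving t).aemeasurable (f := G)
      (by rw [(hT.measurePreserving t).map_eq]; exact hG.1)
    rw [(hT.measurePreserving t).map_eq] at h
    exact h.symm
  simp [this, hab]

end IsMeasurableFlow

/-- Cauchy–Schwarz against the constant 1: expand the integral of `(‖φ‖ - c)²`, where `c` is the
mean of `‖φ‖`. -/
theorem sq_integral_norm_le {E : Type*} [NormedAddCommGroup E] {φ : ℝ → E} {a b : ℝ} (hab : a ≤ b)
    (h1 : IntervalIntegrable φ volume a b)
    (h2 : IntervalIntegrable (fun t => ‖φ t‖ ^ 2) volume a b) :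
    (∫ t in a..b, ‖φ t‖) ^ 2 ≤ (b - a) * ∫ t in a..b, ‖φ t‖ ^ 2 := by
  rcases hab.eq_or_lt with rfl | hlt
  · simp
  have hL : 0 < b - a := sub_pos.2 hlt
  set I := ∫ t in a..b, ‖φ t‖
  set c := I / (b - a)
  have h3 : 0 ≤ ∫ t in a..b, (‖φ t‖ ^ 2 - 2 * c * ‖φ t‖ + c ^ 2) :=
    intervalIntegral.integral_nonneg hab fun t _ => by nlinarith [sq_nonneg (‖φ t‖ - c)]
  rw [intervalIntegral.integral_add (h2.sub (h1.norm.const_mul _)) (by simp),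
    intervalIntegral.integral_sub h2 (h1.norm.const_mul _), intervalIntegral.integral_const_mul,
    intervalIntegral.integral_const, smul_eq_mul] at h3
  have hc : c * (b - a) = I := div_mul_cancel₀ _ hL.ne'
  have h4 : 0 ≤ (b - a) * ((∫ t in a..b, ‖φ t‖ ^ 2) - 2 * c * I + (b - a) * c ^ 2) :=
    mul_nonneg hL.le h3
  have h5 : (b - a) * ((∫ t in a..b, ‖φ t‖ ^ 2) - 2 * c * I + (b - a) * c ^ 2) =
    (b - a) * (∫ t in a..b, ‖φ t‖ ^ 2) - 2 * (c * (b - a)) * I + (c * (b - a)) ^ 2 := by ring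
  rw [h5, hc] at h4
  nlinarith

/-- Orbit integrals of a square integrable function, with a bounded continuous weight, are square
integrable. -/
theorem IsMeasurableFlow.memLp_intervalIntegral {Ω : Type*} [MeasurableSpace Ω] {μ : Measure Ω}
    [IsProbabilityMeasure μ] {T : ℝ → Ω → Ω} (hT : IsMeasurableFlow T μ) {f : Ω → ℂ}
    (hf : MemLp f 2 μ) {e : ℝ → ℂ} (he : Continuous e) (he1 : ∀ t, ‖e t‖ ≤ 1) (a b : ℝ) :
    MemLp (fun ω => ∫ t in a..b, f (T t ω) * e t) 2 μ := by
  wlog hab : a ≤ b generalizing a b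
  · refine (this b a (le_of_not_ge hab)).neg.congr_norm
      (hT.integrable_intervalIntegral (hf.integrable one_le_two) he he1 a b).1 (.of_forall fun ω => ?_)
    simp [intervalIntegral.integral_symm a b]
  have hf1 : Integrable f μ := hf.integrable one_le_two
  have hf2 : Integrable (fun ω => ‖f ω‖ ^ 2) μ := hf.integrable_norm_pow two_ne_zero
  have hm := hT.integrable_intervalIntegral hf1 he he1 a b
  rw [memLp_two_iff_integrable_sq_norm hm.1]
  have hd : Integrable (fun ω => (b - a) * ∫ t in a..b, ‖f (T t ω)‖ ^ 2) μ := by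
    simpa using (hT.integrable_intervalIntegral hf2 (e := fun _ => 1) continuous_const
      (by simp) a b).const_mul (b - a)
  refine hd.mono' (hm.1.norm.pow 2) ?_
  filter_upwards [hT.ae_intervalIntegrable hf1, hT.ae_intervalIntegrable hf2] with ω h1 h2
  refine le_trans ?_ (sq_integral_norm_le hab (h1 a b) (h2 a b))
  rw [Real.norm_of_nonneg (by positivity)]
  gcongr
  refine intervalIntegral.norm_integral_le_of_norm_le hab (.of_forall fun t _ => ?_) (h1 a b).norm
  rw [norm_mul]
  exact mul_le_of_le_one_right (norm_nonneg _) (he1 t)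

/-! ### Maximal ergodic theorem, after Garsia -/

section MaximalErgodic

variable {Ω : Type*}

/-- The maximum of `0` and the Birkhoff sums of `g` along `R` of length at most `n`. -/
noncomputable def birkhoffPosMax (R : Ω → Ω) (g : Ω → ℝ) : ℕ → Ω → ℝ
  | 0 => fun _ => 0
  | n + 1 => fun ω => max 0 (g ω + birkhoffPosMax R g n (R ω))

theorem birkhoffPosMax_nonneg (R : Ω → Ω) (g : Ω → ℝ) (n : ℕ) (ω : Ω) :
    0 ≤ birkhoffPosMax R g n ω := by
  cases n with
  | zero => exact le_rfl
  | succ n => exact le_max_left _ _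

theorem birkhoffPosMax_le_succ (R : Ω → Ω) (g : Ω → ℝ) (n : ℕ) (ω : Ω) :
    birkhoffPosMax R g n ω ≤ birkhoffPosMax R g (n + 1) ω := by
  induction n generalizing ω with
  | zero => exact le_max_left _ _
  | succ n ih => exact max_le_max le_rfl (add_le_add le_rfl (ih (R ω)))

theorem birkhoffSum_le_birkhoffPosMax (R : Ω → Ω) (g : Ω → ℝ) {k n : ℕ} (h : k ≤ n) (ω : Ω) :
    birkhoffSum R g k ω ≤ birkhoffPosMax R g n ω := by
  induction n generalizing k ω with
  | zero => simp [Nat.le_zero.1 h, birkhoffPosMax]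
  | succ n ih =>
    cases k with
    | zero => simpa using birkhoffPosMax_nonneg R g (n + 1) ω
    | succ k =>
      rw [birkhoffSum_succ']
      exact (add_le_add le_rfl (ih (Nat.le_of_succ_le_succ h) (R ω))).trans (le_max_right _ _)

variable [MeasurableSpace Ω] {μ : Measure Ω}

theorem integrable_birkhoffPosMax {R : Ω → Ω} (hR : MeasurePreserving R μ μ) {g : Ω → ℝ}
    (hg : Integrable g μ) (n : ℕ) : Integrable (birkhoffPosMax R g n) μ := by
  induction n with
  | zero => exact integrable_zero _ _ _
  | succ n ih =>
    exact (integrable_zero _ _ _).sup (hg.add (hR.integrable_comp_of_integrable ih))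

/-- A form of the maximal ergodic theorem: if almost every point has a positive Birkhoff sum, then
the integral is nonnegative. -/
theorem integral_nonneg_of_ae_exists_birkhoffSum_pos {R : Ω → Ω} (hR : MeasurePreserving R μ μ)
    {g : Ω → ℝ} (hg : Integrable g μ) (h : ∀ᵐ ω ∂μ, ∃ n, 0 < birkhoffSum R g n ω) :
    0 ≤ ∫ ω, g ω ∂μ := by
  set M := birkhoffPosMax R g
  have hM := integrable_birkhoffPosMax hR hg
  have hMR : ∀ n, Integrable (fun ω => M n (R ω)) μ := fun n =>
    hR.integrable_comp_of_integrable (hM n)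
  -- `r n` is the defect in `M (n+1) = g + M n ∘ R`. Integrating and using that `M` increases and
  -- `R` preserves `μ` gives `-∫ r n ≤ ∫ g`; the hypothesis makes the defect vanish eventually at
  -- almost every point.
  set r : ℕ → Ω → ℝ := fun n ω => max 0 (-(g ω + M n (R ω)))
  have hr : ∀ n, Integrable (r n) μ := fun n =>
    (integrable_zero _ _ _).sup (hg.add (hMR n)).neg
  have hle : ∀ n, -∫ ω, r n ω ∂μ ≤ ∫ ω, g ω ∂μ := by
    intro n
    have h1 : ∀ ω, M (n + 1) ω = g ω + M n (R ω) + r n ω := fun ω => by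
      change max 0 (g ω + M n (R ω)) = g ω + M n (R ω) + max 0 (-(g ω + M n (R ω)))
      rcases le_total 0 (g ω + M n (R ω)) with h0 | h0
      · rw [max_eq_right h0, max_eq_left (by linarith), add_zero]
      · rw [max_eq_left h0, max_eq_right (by linarith)]; ring
    have h2 : ∫ ω, M (n + 1) ω ∂μ
        = ∫ ω, g ω ∂μ + ∫ ω, M n (R ω) ∂μ + ∫ ω, r n ω ∂μ := by
      simp only [h1]
      rw [integral_add (f := fun ω => g ω + M n (R ω)) (hg.add (hMR n)) (hr n),
        integral_add hg (hMR n)]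
    have h3 : ∫ ω, M n (R ω) ∂μ = ∫ ω, M n ω ∂μ := by
      have h := integral_map hR.aemeasurable (f := M n) (by rw [hR.map_eq]; exact (hM n).1)
      rw [hR.map_eq] at h
      exact h.symm
    have h4 : ∫ ω, M n ω ∂μ ≤ ∫ ω, M (n + 1) ω ∂μ :=
      integral_mono (hM n) (hM (n + 1)) (birkhoffPosMax_le_succ R g n)
    linarith
  have hlim : Filter.Tendsto (fun n => ∫ ω, r n ω ∂μ) Filter.atTop (nhds (∫ _, (0 : ℝ) ∂μ)) := by
    refine tendsto_integral_of_dominated_convergence (fun ω => |g ω|) (fun n => (hr n).1) hg.abs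
      (fun n => .of_forall fun ω => ?_) ?_
    · have h0 : 0 ≤ M n (R ω) := birkhoffPosMax_nonneg R g n (R ω)
      rw [Real.norm_of_nonneg (le_max_left _ _)]
      exact max_le (abs_nonneg _) (by linarith [neg_abs_le (g ω)])
    · filter_upwards [h] with ω ⟨k, hk⟩
      cases k with
      | zero => simp at hk
      | succ k =>
        refine tendsto_const_nhds.congr' ?_
        filter_upwards [Filter.eventually_ge_atTop k] with n hn
        rw [birkhoffSum_succ'] at hk
        have := birkhoffSum_le_birkhoffPosMax R g hn (R ω)
        exact (max_eq_left (by linarith)).symm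
  have := le_of_tendsto' hlim.neg hle
  simpa using this

end MaximalErgodic

/-- Borel–Cantelli: along a sequence of measure-preserving maps, an integrable function grows
sublinearly. -/
theorem ae_eventually_comp_le_mul {Ω : Type*} [MeasurableSpace Ω] {μ : Measure Ω}
    [IsProbabilityMeasure μ] {R : ℕ → Ω → Ω} (hR : ∀ n, MeasurePreserving (R n) μ μ) {h : Ω → ℝ}
    (hh : Integrable h μ) (h0 : 0 ≤ h) :
    ∀ᵐ ω ∂μ, ∀ ε > 0, ∀ᶠ n : ℕ in Filter.atTop, h (R n ω) ≤ ε * n := by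
  have key : ∀ k : ℕ, ∀ᵐ ω ∂μ, ∀ᶠ n : ℕ in Filter.atTop, (k + 1 : ℝ) * h (R n ω) ≤ n := by
    intro k
    let _ : MeasureSpace Ω := ⟨μ⟩
    have : IsProbabilityMeasure (volume : Measure Ω) := ‹IsProbabilityMeasure μ›
    -- The tail probabilities `μ(X > n)` of an integrable `X ≥ 0` are summable. The factor `k + 1`
    -- reduces all `ε` to countably many.
    have hs := ProbabilityTheory.tsum_prob_mem_Ioi_lt_top (X := fun ω => (k + 1 : ℝ) * h ω)
      (hh.const_mul (k + 1 : ℝ)) (fun ω => mul_nonneg (by positivity) (h0 ω))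
    have he : ∀ n : ℕ, μ (R n ⁻¹' {ω | (k + 1 : ℝ) * h ω ∈ Set.Ioi (n : ℝ)})
        = μ {ω | (k + 1 : ℝ) * h ω ∈ Set.Ioi (n : ℝ)} := fun n =>
      (hR n).measure_preimage
        ((hh.1.const_mul (k + 1 : ℝ)).aemeasurable.nullMeasurable measurableSet_Ioi)
    have hs' : ∑' n : ℕ, μ (R n ⁻¹' {ω | (k + 1 : ℝ) * h ω ∈ Set.Ioi (n : ℝ)}) ≠ ⊤ := by
      simp only [he]
      exact hs.ne
    filter_upwards [ae_eventually_notMem hs'] with ω hω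
    filter_upwards [hω] with n hn
    simpa using hn
  filter_upwards [ae_all_iff.2 key] with ω hω ε hε
  obtain ⟨k, hk⟩ := exists_nat_one_div_lt hε
  filter_upwards [hω k] with n hn
  have hk0 : (0 : ℝ) < k + 1 := by positivity
  have : h (R n ω) ≤ 1 / (k + 1 : ℝ) * n := by
    rw [one_div, inv_mul_eq_div, le_div_iff₀ hk0]; linarith
  exact this.trans (by gcongr)

/-! ### Pointwise ergodic theorem for the flow, upper half -/

namespace IsMeasurableFlow

variable {Ω : Type*} [MeasurableSpace Ω] {μ : Measure Ω} {T : ℝ → Ω → Ω}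

theorem intervalIntegral_apply (hT : IsMeasurableFlow T μ) {E : Type*} [NormedAddCommGroup E]
    [NormedSpace ℝ E] (G : Ω → E) (a b s : ℝ) (ω : Ω) :
    ∫ t in a..b, G (T t (T s ω)) = ∫ t in (a + s)..(b + s), G (T t ω) := by
  simp only [hT.apply_apply]
  exact intervalIntegral.integral_comp_add_right (fun t => G (T t ω)) s

theorem intervalIntegrable_apply (hT : IsMeasurableFlow T μ) {E : Type*} [NormedAddCommGroup E]
    {G : Ω → E} {ω : Ω} (h : ∀ a b : ℝ, IntervalIntegrable (fun t => G (T t ω)) volume a b)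
    (s a b : ℝ) : IntervalIntegrable (fun t => G (T t (T s ω))) volume a b := by
  simp only [hT.apply_apply]
  simpa using (h (a + s) (b + s)).comp_add_right s

theorem birkhoffSum_orbit (hT : IsMeasurableFlow T μ) {G : Ω → ℝ} {ω : Ω}
    (h : ∀ a b : ℝ, IntervalIntegrable (fun t => G (T t ω)) volume a b) (c : ℝ) (n : ℕ) :
    birkhoffSum (T 1) (fun ω => (∫ t in (0 : ℝ)..1, G (T t ω)) - c) n ω
      = (∫ t in (0 : ℝ)..n, G (T t ω)) - c * n := by
  induction n generalizing ω with
  | zero => simp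
  | succ n ih =>
    rw [birkhoffSum_succ', ih (hT.intervalIntegrable_apply h 1), hT.intervalIntegral_apply,
      ← intervalIntegral.integral_add_adjacent_intervals (h 0 1) (h 1 (n + 1 : ℕ))]
    push_cast
    rw [zero_add]
    ring

/-- The shifted interval `[s, n + s]` lies in `[-m, n + m]` for `m ≥ |s|`. The extra piece `[-m, 0]`
is a constant and the extra length is bounded, so any loss in the rate absorbs both. -/
theorem frequently_orbit_of_apply (hT : IsMeasurableFlow T μ) {G : Ω → ℝ} (hG0 : 0 ≤ G) {ω : Ω}
    (h : ∀ a b : ℝ, IntervalIntegrable (fun t => G (T t ω)) volume a b) (s : ℝ) {q q' : ℝ}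
    (hq : q' < q)
    (hf : ∃ᶠ n : ℕ in Filter.atTop, q * n < ∫ t in (0 : ℝ)..n, G (T t (T s ω))) :
    ∃ᶠ n : ℕ in Filter.atTop, q' * n < ∫ t in (0 : ℝ)..n, G (T t ω) := by
  obtain ⟨m, hm⟩ := exists_nat_ge |s|
  obtain ⟨hm1, hm2⟩ := abs_le.1 hm
  set C := ∫ t in (-m : ℝ)..0, G (T t ω)
  have hev : ∀ᶠ n : ℕ in Filter.atTop, q' * (n + m : ℕ) + C ≤ q * n := by
    have h1 : Filter.Tendsto (fun n : ℕ => (q - q') * n) Filter.atTop Filter.atTop :=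
      tendsto_natCast_atTop_atTop.const_mul_atTop (sub_pos.2 hq)
    filter_upwards [h1.eventually_ge_atTop (q' * m + C)] with n hn
    push_cast
    linarith
  have h2 : ∃ᶠ n : ℕ in Filter.atTop,
      q' * (n + m : ℕ) < ∫ t in (0 : ℝ)..(n + m : ℕ), G (T t ω) := by
    refine (hf.and_eventually hev).mono fun n hn => ?_
    rw [hT.intervalIntegral_apply] at hn
    have h3 : ∫ t in (0 + s)..(n + s), G (T t ω) ≤ ∫ t in (-m : ℝ)..(n + m : ℕ), G (T t ω) :=
      intervalIntegral.integral_mono_interval (by linarith)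
        (by linarith [(n.cast_nonneg : (0 : ℝ) ≤ n)])
        (by push_cast; linarith) (.of_forall fun t => hG0 _) (h _ _)
    rw [← intervalIntegral.integral_add_adjacent_intervals (h (-m) 0) (h 0 (n + m : ℕ))] at h3
    linarith [hn.1, hn.2]
  exact (Filter.tendsto_add_atTop_nat m).frequently h2

variable [IsProbabilityMeasure μ]

theorem integrable_orbit_integral (hT : IsMeasurableFlow T μ) {G : Ω → ℝ} (hG : Integrable G μ)
    (a b : ℝ) : Integrable (fun ω => ∫ t in a..b, G (T t ω)) μ := by
  simpa using hT.integrable_intervalIntegral hG (e := fun _ => 1) continuous_const (by simp) a b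

/-- The upper half of the pointwise ergodic theorem for ergodic flows. -/
theorem ae_eventually_integral_le (hT : IsMeasurableFlow T μ) (hErg : IsErgodicFlow T μ)
    {G : Ω → ℝ} (hG : Integrable G μ) (hG0 : 0 ≤ G) :
    ∀ᵐ ω ∂μ, ∀ c > ∫ ω, G ω ∂μ, ∀ᶠ τ : ℝ in Filter.atTop,
      ∫ t in (0 : ℝ)..τ, G (T t ω) ≤ c * τ := by
  have hΓ := hT.ae_intervalIntegrable hG
  -- The set where the upper limit of the averages at integer times exceeds `c`. The rational `q`
  -- leaves room for the loss of rate under a shift.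
  set A : ℝ → Set Ω := fun c => {ω | ∃ q : ℚ, c < q ∧
    ∃ᶠ n : ℕ in Filter.atTop, (q : ℝ) * n < ∫ t in (0 : ℝ)..n, G (T t ω)} with hA
  have hAm : ∀ c, NullMeasurableSet (A c) μ := by
    intro c
    have : A c = ⋃ q : ℚ, ⋃ _ : c < q, ⋂ m : ℕ, ⋃ n : ℕ, ⋃ _ : m ≤ n,
        {ω | (q : ℝ) * n < ∫ t in (0 : ℝ)..n, G (T t ω)} := by
      ext ω
      simp [hA, Filter.frequently_atTop]
    rw [this]
    refine .iUnion fun q => .iUnion fun _ => .iInter fun m => .iUnion fun n => .iUnion fun _ => ?_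
    exact nullMeasurableSet_lt aemeasurable_const (hT.integrable_orbit_integral hG 0 n).aemeasurable
  have hinv : ∀ c s, T s ⁻¹' A c =ᵐ[μ] A c := by
    intro c s
    -- In a finite measure space, one inclusion between sets of equal measure is enough.
    refine ae_eq_of_ae_subset_of_measure_ge ?_
      ((hT.measurePreserving s).measure_preimage (hAm c)).ge
      ((hAm c).preimage (hT.measurePreserving s).quasiMeasurePreserving) (measure_ne_top _ _)
    filter_upwards [hΓ] with ω hω ⟨q, hq, hf⟩
    obtain ⟨q', hcq', hq'q⟩ := exists_rat_btwn hq
    exact ⟨q', hcq', hT.frequently_orbit_of_apply hG0 hω s hq'q hf⟩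
  have hnull : ∀ c > ∫ ω, G ω ∂μ, ∀ᵐ ω ∂μ, ω ∉ A c := by
    intro c hc
    have he := (hAm c).toMeasurable_ae_eq
    rcases hErg (toMeasurable μ (A c)) (measurableSet_toMeasurable _ _) fun s =>
      (((hT.measurePreserving s).quasiMeasurePreserving.preimage_ae_eq he).trans
        (hinv c s)).trans he.symm with h0 | h1
    · rw [measure_toMeasurable] at h0
      exact measure_eq_zero_iff_ae_notMem.1 h0
    -- `T 1` alone need not be ergodic: ergodicity of the whole flow makes `A c` conull, and the
    -- maximal theorem for `T 1` then forces `c ≤ ∫ G`.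
    · exfalso
      have hmem : ∀ᵐ ω ∂μ, ω ∈ A c := by
        filter_upwards [he, measure_eq_zero_iff_ae_notMem.1 h1] with ω h2 h3
        rw [Set.mem_compl_iff, not_not] at h3
        exact h2.mp h3
      have hi := (hT.integrable_orbit_integral hG 0 1)
      have := integral_nonneg_of_ae_exists_birkhoffSum_pos (hT.measurePreserving 1)
        (hi.sub (integrable_const c)) (by
          filter_upwards [hmem, hΓ] with ω ⟨q, hq, hf⟩ hω
          obtain ⟨n, hn, hn0⟩ := (hf.and_eventually (Filter.eventually_gt_atTop 0)).exists
          refine ⟨n, ?_⟩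
          have h4 := hT.birkhoffSum_orbit hω c n
          have h5 : c * n < q * n := by gcongr
          change 0 < birkhoffSum (T 1) (fun ω => (∫ t in (0 : ℝ)..1, G (T t ω)) - c) n ω
          rw [h4]
          linarith)
      change 0 ≤ ∫ ω, ((∫ t in (0 : ℝ)..1, G (T t ω)) - c) ∂μ at this
      rw [integral_sub hi (integrable_const c),
        hT.integral_intervalIntegral hG zero_le_one] at this
      simp at this
      linarith
  have hall : ∀ᵐ ω ∂μ, ∀ c : ℚ, (c : ℝ) > ∫ ω, G ω ∂μ → ω ∉ A c :=
    ae_all_iff.2 fun c => Filter.eventually_imp_distrib_left.2 (hnull c)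
  filter_upwards [hall, hΓ] with ω hω hint c hc
  -- `c₁` selects the null set, `c₂ > c₁` is the resulting bound at integers, and the gap `c - c₂`
  -- absorbs rounding `τ` up.
  obtain ⟨c₁, h1, h1'⟩ := exists_rat_btwn hc
  obtain ⟨c₂, h2, h2'⟩ := exists_rat_btwn h1'
  have hc0 : (0 : ℝ) < c₂ := lt_of_le_of_lt (integral_nonneg hG0) (h1.trans h2)
  have h3 : ∀ᶠ n : ℕ in Filter.atTop, ∫ t in (0 : ℝ)..n, G (T t ω) ≤ c₂ * n := by
    have h4 := hω c₁ h1
    by_contra h5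
    refine h4 ⟨c₂, h2, fun h6 => h5 ?_⟩
    filter_upwards [h6] with n hn
    exact not_lt.1 hn
  have h4 : Filter.Tendsto (fun τ : ℝ => (c - c₂) * τ) Filter.atTop Filter.atTop :=
    Filter.tendsto_id.const_mul_atTop (sub_pos.2 h2')
  filter_upwards [(tendsto_nat_ceil_atTop (α := ℝ)).eventually h3, h4.eventually_ge_atTop (c₂ : ℝ),
    Filter.eventually_ge_atTop 0] with τ h5 h6 h7
  have h8 : ∫ t in (0 : ℝ)..τ, G (T t ω) ≤ ∫ t in (0 : ℝ)..(⌈τ⌉₊ : ℝ), G (T t ω) :=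
    intervalIntegral.integral_mono_interval le_rfl h7 (Nat.le_ceil τ)
      (.of_forall fun t => hG0 _) (hint _ _)
  have h9 : (c₂ : ℝ) * ⌈τ⌉₊ ≤ c₂ * (τ + 1) := by gcongr; exact (Nat.ceil_lt_add_one h7).le
  linarith

/-- The integral over a window of fixed length along the orbit grows sublinearly. -/
theorem ae_eventually_integral_window_le (hT : IsMeasurableFlow T μ) {G : Ω → ℝ}
    (hG : Integrable G μ) (hG0 : 0 ≤ G) (L : ℝ) (hL : 0 ≤ L) :
    ∀ᵐ ω ∂μ, ∀ ε > 0, ∀ᶠ τ : ℝ in Filter.atTop,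
      ∫ t in τ..(τ + L), G (T t ω) ≤ ε * τ := by
  have h := ae_eventually_comp_le_mul (fun n : ℕ => hT.measurePreserving n)
    -- A window of length `L + 1` starting at `⌊τ⌋` covers `[τ, τ + L]`.
    (hT.integrable_orbit_integral hG 0 (L + 1))
    (fun ω => intervalIntegral.integral_nonneg (by positivity) fun t _ => hG0 _)
  filter_upwards [h, hT.ae_intervalIntegrable hG] with ω hω hint ε hε
  filter_upwards [(tendsto_nat_floor_atTop (α := ℝ)).eventually (hω ε hε),
    Filter.eventually_ge_atTop 0] with τ h1 h2
  have h3 : (⌊τ⌋₊ : ℝ) ≤ τ := Nat.floor_le h2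
  have h4 : τ < ⌊τ⌋₊ + 1 := Nat.lt_floor_add_one τ
  rw [hT.intervalIntegral_apply] at h1
  have h5 : ∫ t in τ..(τ + L), G (T t ω) ≤
      ∫ t in (0 + ⌊τ⌋₊ : ℝ)..(L + 1 + ⌊τ⌋₊ : ℝ), G (T t ω) :=
    intervalIntegral.integral_mono_interval (by linarith) (by linarith) (by linarith)
      (.of_forall fun t => hG0 _) (hint _ _)
  exact h5.trans (h1.trans (by gcongr))

end IsMeasurableFlow

/-! ### Mean convergence of twisted integrals -/

/-- Mean ergodic theorem for cocycles: if `w` is an additive cocycle over a family of contractions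
of a Hilbert space without common nonzero fixed vector, then `w` grows sublinearly. -/
theorem tendsto_inv_smul_cocycle {H : Type*} [NormedAddCommGroup H] [InnerProductSpace ℂ H]
    [CompleteSpace H] (V : ℝ → H →L[ℂ] H) (hV : ∀ t x, ‖V t x‖ ≤ ‖x‖) (w : ℝ → H) (hw0 : w 0 = 0)
    (hw : ∀ t s, w (t + s) = w t + V t (w s)) (hfix : ∀ g, (∀ t, V t g = g) → g = 0) :
    Filter.Tendsto (fun n : ℕ => (n : ℂ)⁻¹ • w n) Filter.atTop (nhds 0) := by
  have hV1 : ‖V 1‖ ≤ 1 := (V 1).opNorm_le_bound zero_le_one fun x => by simpa using hV 1 x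
  have hsum : ∀ n : ℕ, w n = birkhoffSum (V 1) _root_.id n (w 1) := by
    intro n
    induction n with
    | zero => simpa using hw0
    | succ n ih =>
      rw [Nat.cast_succ, add_comm (n : ℝ) 1, hw, ih, birkhoffSum_succ']
      simp [birkhoffSum, Function.iterate_succ_apply', ← Function.iterate_succ_apply]
  obtain ⟨g, hg⟩ : ∃ g, Filter.Tendsto (fun n : ℕ => (n : ℂ)⁻¹ • w n) Filter.atTop (nhds g) := by
    refine ⟨_, ((V 1).tendsto_birkhoffAverage_orthogonalProjection hV1 (w 1)).congr fun n => ?_⟩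
    rw [birkhoffAverage, hsum]
  rwa [hfix g fun t => ?_] at hg
  -- Expanding `w (t + n)` in both orders shows that the limit, a priori fixed only by `V 1`, is
  -- fixed by every `V t`.
  have hcomm : ∀ n : ℕ, V t ((n : ℂ)⁻¹ • w n) = (n : ℂ)⁻¹ • w n + (n : ℂ)⁻¹ • (V n (w t) - w t) := by
    intro n
    have h1 := hw t n
    rw [add_comm, hw] at h1
    rw [map_smul, ← smul_add]
    congr 1
    rw [add_sub, h1]
    abel
  have hz : Filter.Tendsto (fun n : ℕ => (n : ℂ)⁻¹ • (V n (w t) - w t)) Filter.atTop (nhds 0) := by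
    have h1 : Filter.Tendsto (fun n : ℕ => (n : ℝ)⁻¹ * (‖w t‖ + ‖w t‖)) Filter.atTop (nhds 0) := by
      simpa using tendsto_inv_atTop_nhds_zero_nat.mul_const (‖w t‖ + ‖w t‖)
    refine squeeze_zero_norm (fun n => ?_) h1
    rw [norm_smul, norm_inv, Complex.norm_natCast]
    gcongr
    exact (norm_sub_le _ _).trans (add_le_add (hV _ _) le_rfl)
  have h1 := ((V t).continuous.tendsto g).comp hg
  have h2 := hg.add hz
  rw [add_zero] at h2
  exact tendsto_nhds_unique h1 (h2.congr fun n => (hcomm n).symm)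

/-- The character `t ↦ e^{2πiθt}` of `ℝ`. -/
noncomputable def realChar (θ t : ℝ) : ℂ := Complex.exp (2 * Real.pi * Complex.I * θ * t)

theorem realChar_eq (θ t : ℝ) :
    realChar θ t = Complex.exp (Complex.I * (2 * Real.pi * θ * t : ℝ)) := by
  rw [realChar]; congr 1; push_cast; ring

theorem norm_realChar (θ t : ℝ) : ‖realChar θ t‖ = 1 := by
  rw [realChar_eq, mul_comm, Complex.norm_exp_ofReal_mul_I]

theorem continuous_realChar (θ : ℝ) : Continuous (realChar θ) := by
  unfold realChar; fun_prop

theorem realChar_add (θ t s : ℝ) : realChar θ (t + s) = realChar θ t * realChar θ s := by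
  rw [realChar, realChar, realChar, ← Complex.exp_add]; congr 1; push_cast; ring

theorem realChar_mul_neg (θ t : ℝ) : realChar θ t * realChar (-θ) t = 1 := by
  rw [realChar, realChar, ← Complex.exp_add, ← Complex.exp_zero]; congr 1; push_cast; ring

theorem conj_realChar (θ t : ℝ) : (starRingEnd ℂ) (realChar θ t) = realChar (-θ) t := by
  rw [realChar_eq, realChar_eq, ← Complex.exp_conj, map_mul, Complex.conj_I, Complex.conj_ofReal]
  congr 1; push_cast; ring

theorem norm_realChar_sub_le (θ q t : ℝ) :
    ‖realChar θ t - realChar q t‖ ≤ 2 * Real.pi * |θ - q| * |t| := by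
  have h : realChar θ t - realChar q t
      = realChar q t * (Complex.exp (Complex.I * (2 * Real.pi * (θ - q) * t : ℝ)) - 1) := by
    rw [mul_sub, realChar_eq, realChar_eq, ← Complex.exp_add, mul_one]
    congr 2; push_cast; ring
  rw [h, norm_mul, norm_realChar, one_mul]
  refine (Real.norm_exp_I_mul_ofReal_sub_one_le).trans (le_of_eq ?_)
  rw [Real.norm_eq_abs, abs_mul, abs_mul, abs_of_nonneg Real.two_pi_pos.le]

namespace IsMeasurableFlow

variable {Ω : Type*} [MeasurableSpace Ω] {μ : Measure Ω} {T : ℝ → Ω → Ω}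

theorem intervalIntegral_mul_realChar_apply (hT : IsMeasurableFlow T μ) (f : Ω → ℂ)
    (θ b s : ℝ) (ω : Ω) :
    ∫ t in s..(s + b), f (T t ω) * realChar θ t
      = realChar θ s * ∫ t in (0 : ℝ)..b, f (T t (T s ω)) * realChar θ t := by
  simp only [hT.apply_apply]
  rw [← intervalIntegral.integral_const_mul]
  have h := intervalIntegral.integral_comp_add_right (a := 0) (b := b)
    (fun t => f (T t ω) * realChar θ t) s
  rw [zero_add, add_comm b s] at h
  rw [← h]
  refine intervalIntegral.integral_congr fun t _ => ?_
  simp only [realChar_add]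
  ring

theorem _root_.IntervalIntegrable.mul_realChar {φ : ℝ → ℂ} {a b : ℝ}
    (h : IntervalIntegrable φ volume a b) (θ : ℝ) :
    IntervalIntegrable (fun t => φ t * realChar θ t) volume a b :=
  h.mul_continuousOn (continuous_realChar θ).continuousOn

variable [IsProbabilityMeasure μ]

/-- If `t ↦ e^{2πiθt}` is not an eigenvalue, the twisted averages tend to zero in mean. -/
theorem exists_integral_norm_le (hT : IsMeasurableFlow T μ) {f : Ω → ℂ} (hf : MemLp f 2 μ) {θ : ℝ}
    (hθ : ¬ IsFlowEigenvalue hT θ) {ε : ℝ} (hε : 0 < ε) :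
    ∃ N : ℕ, 0 < N ∧
      ∫ ω, ‖∫ t in (0 : ℝ)..N, f (T t ω) * realChar θ t‖ ∂μ ≤ ε * N := by
  -- Integrating `f` against `e(θt)` detects the eigenvalue `-θ`. Conjugating `f` turns this into
  -- `θ`: a vector fixed by all `V t` below is an eigenfunction for `θ`.
  set h : Ω → ℂ := fun ω => (starRingEnd ℂ) (f ω)
  have hh : MemLp h 2 μ := hf.star
  have hm : ∀ t : ℝ, MemLp (fun ω => ∫ s in (0 : ℝ)..t, h (T s ω) * realChar (-θ) s) 2 μ := fun t =>
    hT.memLp_intervalIntegral hh (continuous_realChar _) (fun s => (norm_realChar _ s).le) 0 t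
  set w : ℝ → Lp ℂ 2 μ := fun t => (hm t).toLp _ with hwdef
  set V : ℝ → Lp ℂ 2 μ →L[ℂ] Lp ℂ 2 μ := fun t =>
    realChar (-θ) t • (koopman hT t).toContinuousLinearMap with hVdef
  have hVapp : ∀ t g, V t g = realChar (-θ) t • koopman hT t g := fun t g => rfl
  have hcoc : ∀ t s, w (t + s) = w t + V t (w s) := by
    intro t s
    have hk : koopman hT t (w s) = ((hm s).comp_measurePreserving (hT.measurePreserving t)).toLp _ :=
      rfl
    rw [hVapp, hk, hwdef, ← MemLp.toLp_const_smul, ← MemLp.toLp_add, MemLp.toLp_eq_toLp_iff]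
    filter_upwards [hT.ae_intervalIntegrable (hh.integrable one_le_two)] with ω hω
    have hω' : ∀ a b : ℝ, IntervalIntegrable (fun t => h (T t ω) * realChar (-θ) t) volume a b :=
      fun a b => (hω a b).mul_realChar _
    rw [← intervalIntegral.integral_add_adjacent_intervals (hω' 0 t) (hω' t (t + s)),
      hT.intervalIntegral_mul_realChar_apply]
    rfl
  have hlim := tendsto_inv_smul_cocycle V (fun t x => by
      rw [hVapp, norm_smul, norm_realChar, one_mul, LinearIsometry.norm_map]) w
    (by simp [hwdef]) hcoc fun g hg => by
    by_contra hg0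
    refine hθ ⟨g, hg0, fun t => ?_⟩
    change koopman hT t g = realChar θ t • g
    conv_rhs => rw [← hg t, hVapp, smul_smul, realChar_mul_neg, one_smul]
  obtain ⟨N, hN, hN0⟩ := ((hlim.norm.eventually_lt_const (u := ε) (by simpa using hε)).and
    (Filter.eventually_gt_atTop 0)).exists
  refine ⟨N, hN0, ?_⟩
  have hN0' : (0 : ℝ) < N := by exact_mod_cast hN0
  rw [norm_smul, norm_inv, Complex.norm_natCast, inv_mul_eq_div, div_lt_iff₀ hN0'] at hN
  refine le_trans ?_ hN.le
  have hconj : ∀ ω, ‖∫ t in (0 : ℝ)..N, f (T t ω) * realChar θ t‖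
      = ‖∫ t in (0 : ℝ)..N, h (T t ω) * realChar (-θ) t‖ := by
    intro ω
    rw [← Complex.norm_conj]
    congr 1
    simp only [intervalIntegral.integral_of_le hN0'.le]
    rw [← integral_conj]
    simp only [map_mul, conj_realChar, h]
  simp only [hconj]
  rw [hwdef, Lp.norm_toLp, integral_norm_eq_lintegral_enorm (hm N).1]
  refine ENNReal.toReal_mono (hm N).2.ne ?_
  rw [← eLpNorm_one_eq_lintegral_enorm]
  exact eLpNorm_le_eLpNorm_of_exponent_le one_le_two (hm N).1

end IsMeasurableFlow

/-! ### Deterministic estimates on one orbit -/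

/-- A primitive is controlled by its increments over windows of length `L`. -/
theorem mul_norm_primitive_le {ψ : ℝ → ℂ} (h : ∀ a b : ℝ, IntervalIntegrable ψ volume a b)
    {L τ : ℝ} (hL : 0 ≤ L) (hτ : 0 ≤ τ) :
    L * ‖∫ t in (0 : ℝ)..τ, ψ t‖ ≤ (∫ t in (0 : ℝ)..τ, ‖∫ s in t..(t + L), ψ s‖)
      + ‖∫ x in (0 : ℝ)..L, ∫ t in (0 : ℝ)..x, ψ t‖ + L * ∫ t in τ..(τ + L), ‖ψ t‖ := by
  set Φ : ℝ → ℂ := fun x => ∫ t in (0 : ℝ)..x, ψ t with hΦ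
  have hc : Continuous Φ := intervalIntegral.continuous_primitive h 0
  have hi : ∀ a b : ℝ, IntervalIntegrable Φ volume a b := fun a b => hc.intervalIntegrable a b
  have hsub : ∀ a b : ℝ, ∫ s in a..b, ψ s = Φ b - Φ a := fun a b =>
    (intervalIntegral.integral_interval_sub_left (h 0 b) (h 0 a)).symm
  -- The first integral telescopes to the integral of `Φ` over `[τ, τ + L]` minus that over `[0,
  -- L]`.
  have h1 : (L : ℂ) * Φ τ = (∫ t in (0 : ℝ)..τ, ∫ s in t..(t + L), ψ s)
      + (∫ x in (0 : ℝ)..L, Φ x) - ∫ x in τ..(τ + L), (Φ x - Φ τ) := by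
    simp only [hsub]
    rw [intervalIntegral.integral_sub
        (f := fun t => Φ (t + L))
        ((hc.comp (continuous_add_const L)).intervalIntegrable _ _) (hi _ _),
      intervalIntegral.integral_sub (hi _ _) intervalIntegrable_const,
      intervalIntegral.integral_comp_add_right Φ L, intervalIntegral.integral_const,
      ← intervalIntegral.integral_add_adjacent_intervals (hi τ L) (hi L (τ + L)),
      ← intervalIntegral.integral_add_adjacent_intervals (hi 0 τ) (hi τ L)]
    simp only [add_sub_cancel_left, zero_add, Complex.real_smul]
    ring
  have h2 : ‖∫ t in (0 : ℝ)..τ, ∫ s in t..(t + L), ψ s‖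
      ≤ ∫ t in (0 : ℝ)..τ, ‖∫ s in t..(t + L), ψ s‖ :=
    intervalIntegral.norm_integral_le_integral_norm hτ
  have h3 : ‖∫ x in τ..(τ + L), (Φ x - Φ τ)‖ ≤ L * ∫ t in τ..(τ + L), ‖ψ t‖ := by
    have := intervalIntegral.norm_integral_le_of_norm_le_const (a := τ) (b := τ + L)
      (f := fun x => Φ x - Φ τ) (C := ∫ t in τ..(τ + L), ‖ψ t‖) fun x hx => by
        rw [Set.uIoc_of_le (by linarith)] at hx
        rw [← hsub]
        refine (intervalIntegral.norm_integral_le_integral_norm hx.1.le).trans ?_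
        exact intervalIntegral.integral_mono_interval le_rfl hx.1.le hx.2
          (.of_forall fun t => norm_nonneg _) (h _ _).norm
    rwa [add_sub_cancel_left, abs_of_nonneg hL, mul_comm] at this
  have h4 : L * ‖Φ τ‖ = ‖(L : ℂ) * Φ τ‖ := by
    rw [norm_mul, Complex.norm_real, Real.norm_of_nonneg hL]
  rw [h4, h1]
  exact (norm_sub_le _ _).trans (add_le_add ((norm_add_le _ _).trans (add_le_add h2 le_rfl)) h3)

/-- Dependence of a twisted integral on the frequency. -/
theorem norm_integral_mul_realChar_le {φ : ℝ → ℂ} {L : ℝ} (hL : 0 ≤ L)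
    (h : IntervalIntegrable φ volume 0 L) (θ q : ℝ) :
    ‖∫ t in (0 : ℝ)..L, φ t * realChar θ t‖ ≤ ‖∫ t in (0 : ℝ)..L, φ t * realChar q t‖
      + 2 * Real.pi * |θ - q| * L * ∫ t in (0 : ℝ)..L, ‖φ t‖ := by
  have h1 : ∫ t in (0 : ℝ)..L, φ t * realChar θ t = (∫ t in (0 : ℝ)..L, φ t * realChar q t)
      + ∫ t in (0 : ℝ)..L, φ t * (realChar θ t - realChar q t) := by
    rw [← intervalIntegral.integral_add (h.mul_realChar q)]
    · simp only [mul_sub, add_sub_cancel]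
    · simpa only [mul_sub] using (h.mul_realChar θ).sub (h.mul_realChar q)
  rw [h1]
  refine (norm_add_le _ _).trans (add_le_add le_rfl ?_)
  rw [← intervalIntegral.integral_const_mul]
  refine intervalIntegral.norm_integral_le_of_norm_le hL (.of_forall fun t ht => ?_)
    (h.norm.const_mul _)
  rw [norm_mul, mul_comm]
  gcongr
  refine (norm_realChar_sub_le θ q t).trans ?_
  have := Real.pi_pos
  rw [abs_of_pos ht.1]
  gcongr
  exact ht.2

/-! ### Uniformity in the frequency and conclusion -/

namespace IsMeasurableFlow

variable {Ω : Type*} [MeasurableSpace Ω] {μ : Measure Ω} [IsProbabilityMeasure μ] {T : ℝ → Ω → Ω}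

/-- Quantitative Wiener–Wintner theorem: for almost every `ω`, the orbit of `f` is locally integrable
and all its twisted integrals at frequencies that are not eigenvalues grow sublinearly. -/
theorem ae_wienerWintner (hT : IsMeasurableFlow T μ) (hErg : IsErgodicFlow T μ) {f : Ω → ℂ}
    (hf : MemLp f 2 μ) :
    ∀ᵐ ω ∂μ, (∀ a b : ℝ, IntervalIntegrable (fun t => f (T t ω)) volume a b) ∧
      ∀ θ : ℝ, ¬ IsFlowEigenvalue hT θ → ∀ ε > 0, ∀ᶠ τ : ℝ in Filter.atTop,
        ‖∫ t in (0 : ℝ)..τ, f (T t ω) * realChar θ t‖ ≤ ε * τ := by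
  have hf1 : Integrable f μ := hf.integrable one_le_two
  set B : ℕ → ℝ → Ω → ℝ := fun N q ω => ‖∫ t in (0 : ℝ)..N, f (T t ω) * realChar q t‖ with hB
  set D : ℕ → Ω → ℝ := fun N ω => ∫ t in (0 : ℝ)..N, ‖f (T t ω)‖ with hD
  have hBi : ∀ N q, Integrable (B N q) μ := fun N q =>
    (hT.integrable_intervalIntegral hf1 (continuous_realChar q)
      (fun t => (norm_realChar q t).le) 0 N).norm
  have hDi : ∀ N, Integrable (D N) μ := fun N => hT.integrable_orbit_integral hf1.norm 0 N
  have hB0 : ∀ N q, 0 ≤ B N q := fun N q ω => norm_nonneg _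
  have hD0 : ∀ N, 0 ≤ D N := fun N ω =>
    intervalIntegral.integral_nonneg N.cast_nonneg fun t _ => norm_nonneg _
  have hDint : ∀ N : ℕ, ∫ ω, D N ω ∂μ = N * ∫ ω, ‖f ω‖ ∂μ := fun N => by
    simpa using hT.integral_intervalIntegral hf1.norm (a := 0) (b := N) N.cast_nonneg
  have hBle : ∀ N : ℕ, ∀ ω, (∀ a b : ℝ, IntervalIntegrable (fun t => f (T t ω)) volume a b) →
      ∀ θ q, B N θ ω ≤ B N q ω + 2 * Real.pi * |θ - q| * N * D N ω := fun N ω hω θ q =>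
    norm_integral_mul_realChar_le N.cast_nonneg (hω 0 N) θ q
  have hBerg : ∀ᵐ ω ∂μ, ∀ (N : ℕ) (q : ℚ), (∀ c > ∫ ω, B N q ω ∂μ, ∀ᶠ τ : ℝ in Filter.atTop,
      ∫ t in (0 : ℝ)..τ, B N q (T t ω) ≤ c * τ) ∧
      ∀ a b : ℝ, IntervalIntegrable (fun t => B N q (T t ω)) volume a b :=
    ae_all_iff.2 fun N => ae_all_iff.2 fun q =>
      (hT.ae_eventually_integral_le hErg (hBi N q) (hB0 N q)).and
        (hT.ae_intervalIntegrable (hBi N q))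
  have hDerg : ∀ᵐ ω ∂μ, ∀ N : ℕ, (∀ c > ∫ ω, D N ω ∂μ, ∀ᶠ τ : ℝ in Filter.atTop,
      ∫ t in (0 : ℝ)..τ, D N (T t ω) ≤ c * τ) ∧
      ∀ a b : ℝ, IntervalIntegrable (fun t => D N (T t ω)) volume a b :=
    ae_all_iff.2 fun N =>
      (hT.ae_eventually_integral_le hErg (hDi N) (hD0 N)).and (hT.ae_intervalIntegrable (hDi N))
  have hwin : ∀ᵐ ω ∂μ, ∀ N : ℕ, ∀ ε > 0, ∀ᶠ τ : ℝ in Filter.atTop,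
      ∫ t in τ..(τ + N), ‖f (T t ω)‖ ≤ ε * τ :=
    ae_all_iff.2 fun N => hT.ae_eventually_integral_window_le hf1.norm
      (fun ω => norm_nonneg _) N N.cast_nonneg
  have hΓ := hT.ae_intervalIntegrable hf1
  filter_upwards [hΓ, hBerg, hDerg, hwin] with ω hω hωB hωD hωw
  refine ⟨hω, fun θ hθ ε' hε' => ?_⟩
  -- The six shares: three from the windows at `q`, one each from the change of frequency, the
  -- boundary at 0 and the boundary at `τ`.
  obtain ⟨ε, hε, rfl⟩ : ∃ ε > 0, ε' = 6 * ε := ⟨ε' / 6, by positivity, by ring⟩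
  obtain ⟨N, hN0, hN⟩ := hT.exists_integral_norm_le hf hθ hε
  have hN0' : (0 : ℝ) < N := by exact_mod_cast hN0
  set I := ∫ ω, ‖f ω‖ ∂μ
  have hI : 0 ≤ I := integral_nonneg fun _ => norm_nonneg _
  have hpi := Real.pi_pos
  -- The added 1 makes `K` positive and strictly larger than the mean of `D N`, even if `I = 0`.
  set K := N * I + 1 with hK
  have hKpos : 0 < K := by positivity
  obtain ⟨q, hq⟩ : ∃ q : ℚ, 2 * Real.pi * |θ - q| * K ≤ ε := by
    obtain ⟨q, hq1, hq2⟩ := exists_rat_btwn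
      (show θ < θ + ε / (2 * Real.pi * K) by
        linarith [show 0 < ε / (2 * Real.pi * K) by positivity])
    refine ⟨q, ?_⟩
    have h1 : |θ - q| ≤ ε / (2 * Real.pi * K) := by rw [abs_sub_comm, abs_of_pos] <;> linarith
    rw [le_div_iff₀ (by positivity)] at h1
    linarith
  set κ := 2 * Real.pi * |θ - q| * N with hκ
  have hκ0 : 0 ≤ κ := by positivity
  have hκK : κ * K ≤ ε * N := by
    calc κ * K = 2 * Real.pi * |θ - q| * K * N := by rw [hκ]; ring
      _ ≤ ε * N := by gcongr
  -- The mean is at most `2 * ε * N`; the constant 3 supplies the strict inequality that the ergodic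
  -- bound requires.
  have hBq : ∫ ω, B N q ω ∂μ < 3 * ε * N := by
    have h1 : ∫ ω, B N q ω ∂μ ≤ ∫ ω, (B N θ ω + κ * D N ω) ∂μ := by
      refine integral_mono_ae (hBi N q) ((hBi N θ).add ((hDi N).const_mul κ)) ?_
      filter_upwards [hΓ] with ω hω
      simpa [hκ, abs_sub_comm] using hBle N ω hω q θ
    rw [integral_add (hBi N θ) ((hDi N).const_mul κ), integral_const_mul, hDint] at h1
    have h2 : κ * (N * I) ≤ κ * K := by rw [hK]; gcongr; linarith
    have h3 : 0 < ε * N := by positivity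
    linarith
  have hDK : ∫ ω, D N ω ∂μ < K := by rw [hDint, hK]; linarith
  set C := ‖∫ x in (0 : ℝ)..N, ∫ t in (0 : ℝ)..x, f (T t ω) * realChar θ t‖
  have hεN : 0 < ε * N := by positivity
  filter_upwards [(hωB N q).1 _ hBq, (hωD N).1 K hDK, hωw N ε hε, Filter.eventually_ge_atTop 0,
    (Filter.tendsto_id.const_mul_atTop hεN).eventually_ge_atTop C] with τ h1 h2 h3 hτ h4
  have h5 := mul_norm_primitive_le (fun a b => (hω a b).mul_realChar θ) hN0'.le hτ
  have h6 : (∫ t in (0 : ℝ)..τ, ‖∫ s in t..(t + N), f (T s ω) * realChar θ s‖)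
      ≤ ∫ t in (0 : ℝ)..τ, (B N q (T t ω) + κ * D N (T t ω)) := by
    refine (Real.le_norm_self _).trans (intervalIntegral.norm_integral_le_of_norm_le hτ
      (.of_forall fun t _ => ?_) (((hωB N q).2 _ _).add (((hωD N).2 _ _).const_mul κ)))
    rw [norm_norm, hT.intervalIntegral_mul_realChar_apply, norm_mul, norm_realChar, one_mul]
    exact hBle N (T t ω) (hT.intervalIntegrable_apply hω t) θ q
  rw [intervalIntegral.integral_add ((hωB N q).2 _ _) (((hωD N).2 _ _).const_mul κ),
    intervalIntegral.integral_const_mul] at h6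
  have h7 : κ * ∫ t in (0 : ℝ)..τ, D N (T t ω) ≤ ε * N * τ := by
    calc κ * ∫ t in (0 : ℝ)..τ, D N (T t ω) ≤ κ * (K * τ) := by gcongr
      _ = κ * K * τ := by ring
      _ ≤ ε * N * τ := by gcongr
  simp only [norm_mul (f _), norm_realChar, mul_one] at h5
  have h8 : N * ∫ t in τ..(τ + N), ‖f (T t ω)‖ ≤ N * (ε * τ) := by gcongr
  have h9 : N * ‖∫ t in (0 : ℝ)..τ, f (T t ω) * realChar θ t‖ ≤ N * (6 * ε * τ) := by
    simp only [id] at h4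
    linarith
  exact le_of_mul_le_mul_left h9 hN0'

end IsMeasurableFlow
theorem theorem4 {Ω : Type*} [MeasurableSpace Ω] (μ : MeasureTheory.Measure Ω)
    [MeasureTheory.IsProbabilityMeasure μ] (T : ℝ → Ω → Ω)
    (hT : IsMeasurableFlow T μ) (hErg : IsErgodicFlow T μ)
    (f : Ω → ℂ) (hf : MeasureTheory.MemLp f 2 μ) :
    ∃ Ω' : Set Ω, MeasurableSet Ω' ∧ μ Ω'ᶜ = 0 ∧
      ∀ ω ∈ Ω',
        (∀ τ : ℝ, IntervalIntegrable (fun t : ℝ => f (T t ω)) MeasureTheory.volume 0 τ) ∧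
        ∀ θ : ℝ, ¬ IsFlowEigenvalue hT θ →
          Filter.Tendsto
            (fun τ : ℝ => (1 / (τ : ℂ)) *
              ∫ t in (0 : ℝ)..τ, f (T t ω) * Complex.exp (2 * Real.pi * Complex.I * θ * t))
            Filter.atTop (nhds 0) := by
  obtain ⟨S, hS, hSm, hS0⟩ :=
    exists_measurable_superset_of_null (ae_iff.1 (hT.ae_wienerWintner hErg hf))
  refine ⟨Sᶜ, hSm.compl, by rwa [compl_compl], fun ω hω => ?_⟩
  have hgood := not_not.1 fun h => hω (hS h)
  refine ⟨fun τ => hgood.1 0 τ, fun θ hθ => ?_⟩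
  rw [Metric.tendsto_nhds]
  intro ε hε
  filter_upwards [hgood.2 θ hθ (ε / 2) (half_pos hε), Filter.eventually_gt_atTop 0] with τ h1 hτ
  rw [dist_zero_right, norm_mul, norm_div, norm_one, Complex.norm_real,
    Real.norm_of_nonneg hτ.le, one_div, inv_mul_eq_div, div_lt_iff₀ hτ]
  exact h1.trans_lt (by gcongr; linarith)
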